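/- For an integer $k\ge 1$ define $F_k:\mathbb N\to\mathbb N$ by $F_k(0)=0$ and $F_k(n)=n-F_k^k(n-1)$ for $n\ge 1$, where the exponent of a function denotes iteration. Let $\tau_k$ be the substitution on the alphabet $\{1,\dots,k\}$ given by $k\mapsto k1$ and $i\mapsto i+1$ for $1\le i<k$, and let $x_k=x_k[0]x_k[1]\cdots$ be the infinite word fixed by $\tau_k$. Let $L_k(n)=|\tau_k(x_k[0]\cdots x_k[n-1])|$ for $n\ge 0$, and write $L_k^j$ for its $j$-th iterate. For a letter $1\le i\le k$, let $\mathrm{freq}_k(i)$ denote the limit $\lim_{n\to\infty}\frac1n\#\{0\le p<n : x_k[p]=i\}$. Let $\alpha_k$ be the unique positive root of $X^k+X-1$ and let $\beta_k$ be the unique positive root of $X^k-X^{k-1}-1$, so that $\beta_k=1/\alpha_k$. Theorem. For all $j\ge 0$ and $k\ge 1$, the following limits exist and have the given values: $$\lim_{n\to\infty}\tfrac1n F_k^j(n)=\alpha_k^j,\qquad \lim_{n\to\infty}\tfrac1n L_k^j(n)=\beta_k^j,$$ $$\mathrm{freq}_k(i)=\alpha_k^{k+i-1}\ \text{ for } 1\le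 i<k,\qquad \mathrm{freq}_k(k)=\alpha_k^{k-1}=\beta_k-1.$$ -/

import Mathlib

namespace Hofstadter

/-! ### The functions `F_k` -/

/-- `hofTable k n` is a function whose values at `0, …, n` are those of Hofstadter's `F_k`
(and which is `0` above `n`). -/
def hofTable (k : ℕ) : ℕ → ℕ → ℕ
  | 0 => fun _ => 0
  | n + 1 => Function.update (hofTable k n) (n + 1) (n + 1 - (hofTable k n)^[k] n)

/-- Hofstadter's function `F_k`, i.e. `F_k(0) = 0` and `F_k(n) = n - F_k^k(n-1)` for `n ≥ 1`,
the exponent being iteration; see `hofF_zero` and `hofF_succ` for these two equations. -/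
def hofF (k n : ℕ) : ℕ := hofTable k n n

theorem hofF_le (k n : ℕ) : hofF k n ≤ n := by
  cases n with
  | zero => simp [hofF, hofTable]
  | succ n => simp [hofF, hofTable]

theorem hofTable_eq (k n m : ℕ) (h : m ≤ n) : hofTable k n m = hofF k m := by
  induction n with
  | zero =>
    obtain rfl : m = 0 := by omega
    rfl
  | succ n ih =>
    rcases Nat.lt_or_ge n m with h' | h'
    · obtain rfl : m = n + 1 := by omega
      rfl
    · have hne : m ≠ n + 1 := by omega
      simp [hofTable, Function.update_of_ne hne, ih h']

theorem hofF_zero (k : ℕ) : hofF k 0 = 0 := rfl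

theorem hofF_succ (k n : ℕ) : hofF k (n + 1) = n + 1 - (hofF k)^[k] n := by
  have key : ∀ i : ℕ, (hofTable k n)^[i] n = (hofF k)^[i] n ∧ (hofF k)^[i] n ≤ n := by
    intro i
    induction i with
    | zero => simp
    | succ i ih =>
      rw [Function.iterate_succ_apply', Function.iterate_succ_apply', ih.1]
      exact ⟨hofTable_eq k n _ ih.2, (hofF_le k _).trans ih.2⟩
  rw [← (key k).1]
  simp [hofF, hofTable]

/-- The subtraction in `hofF_succ` is not truncated. -/
theorem hofF_succ_add (k n : ℕ) : hofF k (n + 1) + (hofF k)^[k] n = n + 1 := by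
  have key : ∀ i : ℕ, (hofF k)^[i] n ≤ n := by
    intro i
    induction i with
    | zero => simp
    | succ i ih =>
      rw [Function.iterate_succ_apply']
      exact (hofF_le k _).trans ih
  have := key k
  rw [hofF_succ]
  omega

/-! ### The substitutions `τ_k` and the words `x_k` -/

/-- The image of a letter under `τ_k`: `k ↦ k1` and `i ↦ i+1` for the other letters. -/
def tauLetter (k i : ℕ) : List ℕ := if i = k then [k, 1] else [i + 1]

/-- The substitution `τ_k` on finite words. The alphabet is `{1, …, k}`, embedded in `ℕ`. -/
def tau (k : ℕ) (w : List ℕ) : List ℕ := w.flatMap (tauLetter k)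

/-- The prefix `w[0] w[1] ⋯ w[n-1]` of length `n` of the infinite word `w`. -/
def pref (w : ℕ → ℕ) (n : ℕ) : List ℕ := (List.range n).map w

/-- The infinite word `w` satisfies `τ_k(w) = w`: the image of each prefix is a prefix of `w`
(images of letters are nonempty, so these images have unbounded lengths). -/
def IsFixedWord (k : ℕ) (w : ℕ → ℕ) : Prop :=
  ∀ n, tau k (pref w n) = pref w (tau k (pref w n)).length

/-- The infinite word `x_k`, the limit of the words `τ_k^n(k)`, each of which is a prefix of the
next. It is the unique fixed point of `τ_k`, see `isFixedWord_iff`. -/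
def word (k n : ℕ) : ℕ := ((tau k)^[n] [k]).getD n 0

theorem length_pref (w : ℕ → ℕ) (n : ℕ) : (pref w n).length = n := by simp [pref]

theorem tau_append (k : ℕ) (u v : List ℕ) : tau k (u ++ v) = tau k u ++ tau k v := by
  simp [tau]

theorem tau_prefix (k : ℕ) {u v : List ℕ} (h : u <+: v) : tau k u <+: tau k v := by
  obtain ⟨t, rfl⟩ := h
  exact ⟨tau k t, (tau_append k u t).symm⟩

theorem length_le_length_tau (k : ℕ) (w : List ℕ) : w.length ≤ (tau k w).length := by
  induction w with
  | nil => simp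
  | cons a w ih =>
    have : 1 ≤ (tauLetter k a).length := by unfold tauLetter; split <;> simp
    simp only [tau, List.flatMap_cons, List.length_append, List.length_cons] at ih ⊢
    omega

theorem iterate_prefix_succ (k n : ℕ) : (tau k)^[n] [k] <+: (tau k)^[n + 1] [k] := by
  induction n with
  | zero => exact ⟨[1], by simp [tau, tauLetter]⟩
  | succ n ih =>
    rw [Function.iterate_succ_apply', Function.iterate_succ_apply' _ (n + 1)]
    exact tau_prefix k ih

theorem iterate_prefix (k : ℕ) {m n : ℕ} (h : m ≤ n) : (tau k)^[m] [k] <+: (tau k)^[n] [k] := by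
  induction n, h using Nat.le_induction with
  | base => exact List.prefix_refl _
  | succ n _ ih => exact ih.trans (iterate_prefix_succ k n)

theorem lt_length_iterate (k n : ℕ) : n < ((tau k)^[n] [k]).length := by
  induction n with
  | zero => simp
  | succ n ih =>
    obtain ⟨t, ht⟩ := iterate_prefix k (Nat.zero_le n)
    rw [Function.iterate_succ_apply']
    rw [← ht] at ih ⊢
    have := length_le_length_tau k t
    rw [tau_append]
    simp [tau, tauLetter] at this ih ⊢
    omega

theorem pref_word (k j : ℕ) :
    pref (word k) ((tau k)^[j] [k]).length = (tau k)^[j] [k] := by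
  apply List.ext_getElem (length_pref _ _)
  intro n h1 h2
  simp only [pref, List.getElem_map, List.getElem_range, word]
  have hn := lt_length_iterate k n
  rw [List.getD_eq_getElem _ _ hn]
  rcases le_total n j with h | h
  · exact (iterate_prefix k h).getElem hn
  · exact ((iterate_prefix k h).getElem h2).symm

theorem pref_prefix (w : ℕ → ℕ) {m n : ℕ} (h : m ≤ n) : pref w m <+: pref w n := by
  obtain ⟨d, rfl⟩ := Nat.exists_eq_add_of_le h
  exact ⟨(List.range d).map (fun i => w (m + i)), by simp [pref, List.range_add]⟩

theorem eq_pref_of_prefix (w : ℕ → ℕ) {u : List ℕ} {n : ℕ} (h : u <+: pref w n) :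
    u = pref w u.length := by
  have hl : u.length ≤ n := by simpa [length_pref] using h.length_le
  have h' := List.prefix_of_prefix_length_le h (pref_prefix w hl) (by rw [length_pref])
  exact h'.eq_of_length (by rw [length_pref])

theorem isFixedWord_word (k : ℕ) : IsFixedWord k (word k) := by
  intro n
  have h1 : pref (word k) n <+: (tau k)^[n] [k] := by
    rw [← pref_word k n]
    exact pref_prefix _ (lt_length_iterate k n).le
  have h2 := tau_prefix k h1
  rw [← Function.iterate_succ_apply' (tau k) n, ← pref_word k (n + 1)] at h2
  exact eq_pref_of_prefix _ h2

/-- `x_k` is the only infinite word fixed by `τ_k`. -/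
theorem isFixedWord_iff (k : ℕ) (w : ℕ → ℕ) : IsFixedWord k w ↔ w = word k := by
  refine ⟨fun h => ?_, fun h => h ▸ isFixedWord_word k⟩
  have h0 : w 0 = k := by
    by_contra hne
    have := h 1
    simp [pref, tau, tauLetter, hne] at this
  have hw : ∀ j, (tau k)^[j] [k] = pref w ((tau k)^[j] [k]).length := by
    intro j
    induction j with
    | zero => simp [pref, h0]
    | succ j ih =>
      rw [Function.iterate_succ_apply']
      rw [ih]
      exact h _
  funext n
  have hn := lt_length_iterate k n
  have e : pref w ((tau k)^[n] [k]).length = pref (word k) ((tau k)^[n] [k]).length := by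
    rw [← hw, pref_word]
  have := congrArg (fun l : List ℕ => l.getD n 0) e
  simpa [pref, hn] using this

/-- The letters of `x_k` belong to the alphabet `{1, …, k}`. -/
theorem word_mem (k : ℕ) (hk : 1 ≤ k) (n : ℕ) : 1 ≤ word k n ∧ word k n ≤ k := by
  have key : ∀ j, ∀ a ∈ (tau k)^[j] [k], 1 ≤ a ∧ a ≤ k := by
    intro j
    induction j with
    | zero => simp [hk]
    | succ j ih =>
      intro a ha
      rw [Function.iterate_succ_apply'] at ha
      simp only [tau, List.mem_flatMap] at ha
      obtain ⟨b, hb, hab⟩ := ha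
      have := ih b hb
      unfold tauLetter at hab
      split at hab <;> simp at hab <;> omega
  have hn := lt_length_iterate k n
  apply key n
  rw [word, List.getD_eq_getElem _ _ hn]
  exact List.getElem_mem hn

/-- `L_k(n)`, the length of the image under `τ_k` of the prefix of length `n` of `x_k`. -/
def lenL (k n : ℕ) : ℕ := (tau k (pref (word k) n)).length

/-- The number of occurrences of the letter `i` in the prefix of length `n` of `x_k`. -/
def letterCount (k i n : ℕ) : ℕ := ((Finset.range n).filter (fun p => word k p = i)).card

/-- The frequency of the letter `i` in `x_k`, i.e. the limit of the proportion of the letters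
equal to `i` in the prefix of length `n`, exists and is equal to `ℓ`. -/
def HasFreq (k i : ℕ) (ℓ : ℝ) : Prop :=
  Filter.Tendsto (fun n : ℕ => (letterCount k i n : ℝ) / (n : ℝ)) Filter.atTop (nhds ℓ)

/-! ### The numbers `α_k` and `β_k` -/

/-- `P_k = X^k + X - 1`. -/
noncomputable def polyP (k : ℕ) : Polynomial ℝ := Polynomial.X ^ k + Polynomial.X - 1

/-- `Q_k = X^k - X^(k-1) - 1` (used for `k ≥ 1`). -/
noncomputable def polyQ (k : ℕ) : Polynomial ℝ :=
  Polynomial.X ^ k - Polynomial.X ^ (k - 1) - 1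

theorem existsUnique_root_polyP (k : ℕ) (hk : 1 ≤ k) :
    ∃! x : ℝ, 0 < x ∧ (polyP k).IsRoot x := by
  have hk0 : k ≠ 0 := by omega
  have hiff : ∀ x : ℝ, (polyP k).IsRoot x ↔ x ^ k + x = 1 := by
    intro x
    simp [polyP, Polynomial.IsRoot, sub_eq_zero]
  have hc : ContinuousOn (fun x : ℝ => x ^ k + x) (Set.Icc 0 1) := by fun_prop
  have h1 : (1 : ℝ) ∈ Set.Icc ((fun x : ℝ => x ^ k + x) 0) ((fun x : ℝ => x ^ k + x) 1) := by
    simp [hk0]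
  obtain ⟨x, hx, hx1⟩ := intermediate_value_Icc (zero_le_one' ℝ) hc h1
  have hx1' : x ^ k + x = 1 := hx1
  have hxpos : 0 < x := by
    rcases hx.1.lt_or_eq with h | h
    · exact h
    · rw [← h] at hx1'
      simp [hk0] at hx1'
  refine ⟨x, ⟨hxpos, (hiff x).2 hx1'⟩, ?_⟩
  rintro y ⟨hy, hyr⟩
  have hy1 := (hiff y).1 hyr
  rcases lt_trichotomy x y with h | h | h
  · have := pow_lt_pow_left₀ h hxpos.le hk0
    linarith
  · exact h.symm
  · have := pow_lt_pow_left₀ h hy.le hk0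
    linarith

theorem isRoot_polyQ_iff (k : ℕ) (hk : 1 ≤ k) (x : ℝ) (hx : 0 < x) :
    (polyQ k).IsRoot x ↔ (polyP k).IsRoot (1 / x) := by
  obtain ⟨m, rfl⟩ := Nat.exists_eq_add_of_le' hk
  have hm : x ^ m ≠ 0 := (pow_pos hx m).ne'
  have hx0 : x ≠ 0 := hx.ne'
  have e : x ^ (m + 1) - x ^ m - 1 = -(x ^ (m + 1)) * ((1 / x) ^ (m + 1) + 1 / x - 1) := by
    rw [one_div, inv_pow, pow_succ]
    field_simp
    ring
  have hne : -(x ^ (m + 1)) ≠ 0 := neg_ne_zero.2 (pow_pos hx _).ne'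
  have hQ : (polyQ (m + 1)).IsRoot x ↔ x ^ (m + 1) - x ^ m - 1 = 0 := by
    simp [polyQ, Polynomial.IsRoot]
  have hP : (polyP (m + 1)).IsRoot (1 / x) ↔ (1 / x) ^ (m + 1) + 1 / x - 1 = 0 := by
    simp [polyP, Polynomial.IsRoot]
  rw [hQ, hP, e, mul_eq_zero]
  simp only [hne, false_or]

theorem existsUnique_root_polyQ (k : ℕ) (hk : 1 ≤ k) :
    ∃! x : ℝ, 0 < x ∧ (polyQ k).IsRoot x := by
  obtain ⟨a, ⟨ha, har⟩, hu⟩ := existsUnique_root_polyP k hk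
  refine ⟨1 / a, ⟨by positivity, ?_⟩, ?_⟩
  · rw [isRoot_polyQ_iff k hk _ (by positivity), one_div_one_div]
    exact har
  · rintro y ⟨hy, hyr⟩
    rw [isRoot_polyQ_iff k hk y hy] at hyr
    have := hu (1 / y) ⟨by positivity, hyr⟩
    rw [← this, one_div_one_div]

/-- `α_k`, the unique positive root of `P_k`, for `k ≥ 1`. -/
noncomputable def alpha (k : ℕ) (hk : 1 ≤ k) : ℝ := (existsUnique_root_polyP k hk).choose

/-- `β_k`, the unique positive root of `Q_k`, for `k ≥ 1`. -/
noncomputable def beta (k : ℕ) (hk : 1 ≤ k) : ℝ := (existsUnique_root_polyQ k hk).choose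

theorem alpha_spec (k : ℕ) (hk : 1 ≤ k) : 0 < alpha k hk ∧ (polyP k).IsRoot (alpha k hk) :=
  (existsUnique_root_polyP k hk).choose_spec.1

theorem beta_spec (k : ℕ) (hk : 1 ≤ k) : 0 < beta k hk ∧ (polyQ k).IsRoot (beta k hk) :=
  (existsUnique_root_polyQ k hk).choose_spec.1

theorem beta_eq (k : ℕ) (hk : 1 ≤ k) : beta k hk = 1 / alpha k hk := by
  obtain ⟨hb, hbr⟩ := beta_spec k hk
  rw [isRoot_polyQ_iff k hk _ hb] at hbr
  have := (existsUnique_root_polyP k hk).unique ⟨by positivity, hbr⟩ (alpha_spec k hk)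
  rw [← this, one_div_one_div]

end Hofstadter

/-!
The length function `L = L_k` satisfies `L(n) = n + #{p < n : x_k[p] = k}`. After `k - 1` steps
every letter of a word has produced exactly one `k`, at the start of its image, so
`n ↦ #{p < n : x_k[p] = k}` is the lower adjoint of `L^(k-1)`, whence
`L^k(n) = L^(k-1)(n) + n`. If `g` is the lower adjoint of `L`, then `L(m) = m + g^(k-1)(m)` turns
the adjunction into the recursion of `F_k`, so `g = F_k`.

For fixed `n` the numbers `u(p) = α^p L^p(n)` satisfy
`u(p + k) = α u(p + k - 1) + (1 - α) u(p)`, as `α^k = 1 - α`. Such averages have oscillation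
decaying geometrically, uniformly in `n`, so `L(m) ≈ m / α` for `m` in the range of `L^p`, and this
range has bounded gaps. The other limits follow by transport along `F_k` and `L_k`.
-/

namespace Hofstadter

open Filter Topology

/-! ### Sequences with a linear rate of growth -/

theorem tendsto_natCast_div_self : Tendsto (fun n : ℕ => (n : ℝ) / n) atTop (𝓝 1) := by
  refine tendsto_const_nhds.congr' ?_
  filter_upwards [eventually_ne_atTop 0] with n hn
  exact (div_self (Nat.cast_ne_zero.2 hn)).symm

theorem tendsto_div_of_abs_sub_le_mul_add {u : ℕ → ℝ} {c : ℝ}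
    (h : ∀ ε > 0, ∃ K, ∀ n : ℕ, |u n - c * n| ≤ ε * n + K) :
    Tendsto (fun n : ℕ => u n / n) atTop (𝓝 c) := by
  rw [Metric.tendsto_atTop']
  intro ε hε
  obtain ⟨K, hK⟩ := h (ε / 2) (half_pos hε)
  obtain ⟨n₀, hn₀⟩ := exists_nat_gt (K / (ε / 2))
  refine ⟨n₀, fun n hn => ?_⟩
  have hn_pos : (0 : ℝ) < n := Nat.cast_pos.2 (Nat.zero_lt_of_lt hn)
  have hKn : K < ε / 2 * n :=
    (div_lt_iff₀' (half_pos hε)).1 (hn₀.trans (Nat.cast_lt.2 hn))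
  calc dist (u n / n) c = |u n - c * n| / n := by
        rw [Real.dist_eq, div_sub' hn_pos.ne', abs_div, abs_of_pos hn_pos, mul_comm c]
    _ < ε := by
        rw [div_lt_iff₀ hn_pos]
        linarith [hK n]

theorem tendsto_div_of_abs_sub_le {u v : ℕ → ℝ} {c C : ℝ}
    (hu : Tendsto (fun n : ℕ => u n / n) atTop (𝓝 c)) (h : ∀ n, |v n - u n| ≤ C) :
    Tendsto (fun n : ℕ => v n / n) atTop (𝓝 c) := by
  have hdiff : Tendsto (fun n : ℕ => (v n - u n) / n) atTop (𝓝 0) :=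
    tendsto_bdd_div_atTop_nhds_zero (.of_forall fun n => (abs_le.1 (h n)).1)
      (.of_forall fun n => (abs_le.1 (h n)).2) tendsto_natCast_atTop_atTop
  simpa [sub_div] using hu.add hdiff

theorem tendsto_atTop_of_tendsto_div {f : ℕ → ℕ} {c : ℝ} (hc : 0 < c)
    (hf : Tendsto (fun n => (f n : ℝ) / n) atTop (𝓝 c)) : Tendsto f atTop atTop := by
  rw [← tendsto_natCast_atTop_iff (R := ℝ)]
  refine (hf.pos_mul_atTop hc tendsto_natCast_atTop_atTop).congr' ?_
  filter_upwards [eventually_ne_atTop 0] with n hn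
  exact div_mul_cancel₀ _ (Nat.cast_ne_zero.2 hn)

theorem tendsto_comp_div {u : ℕ → ℝ} {g : ℕ → ℕ} {b c : ℝ} (hc : 0 < c)
    (hu : Tendsto (fun n : ℕ => u n / n) atTop (𝓝 b))
    (hg : Tendsto (fun n => (g n : ℝ) / n) atTop (𝓝 c)) :
    Tendsto (fun n : ℕ => u (g n) / n) atTop (𝓝 (b * c)) := by
  have hg_top := tendsto_atTop_of_tendsto_div hc hg
  refine ((hu.comp hg_top).mul hg).congr' ?_
  filter_upwards [hg_top.eventually_ne_atTop 0] with n hn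
  exact div_mul_div_cancel₀ (Nat.cast_ne_zero.2 hn)

theorem tendsto_iterate_div {f : ℕ → ℕ} {c : ℝ} (hc : 0 < c)
    (hf : Tendsto (fun n => (f n : ℝ) / n) atTop (𝓝 c)) (j : ℕ) :
    Tendsto (fun n => (f^[j] n : ℝ) / n) atTop (𝓝 (c ^ j)) := by
  induction j with
  | zero => simpa using tendsto_natCast_div_self
  | succ j ih =>
    rw [pow_succ]
    exact tendsto_comp_div (u := fun n => (f^[j] n : ℝ)) hc ih hf

/-! ### Lower adjoints of functions with bounded gaps -/

theorem exists_lowerAdjoint {f : ℕ → ℕ} (hf : StrictMono f) :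
    ∃ g : ℕ → ℕ, GaloisConnection g f := by
  have hex (n : ℕ) : ∃ m, n ≤ f m := ⟨n, hf.le_apply⟩
  exact ⟨fun n => Nat.find (hex n), fun n m =>
    ⟨fun h => (Nat.find_spec (hex n)).trans (hf.monotone h), fun h => Nat.find_le h⟩⟩

theorem galoisConnection_iterate {α : Type*} [Preorder α] {f g : α → α}
    (gc : GaloisConnection g f) (j : ℕ) : GaloisConnection g^[j] f^[j] := by
  induction j with
  | zero => exact GaloisConnection.id
  | succ j ih =>
    rw [Function.iterate_succ', Function.iterate_succ]
    exact ih.compose gc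

theorem apply_add_le {f : ℕ → ℕ} {C : ℕ} (hC : ∀ n, f (n + 1) ≤ f n + C) (n d : ℕ) :
    f (n + d) ≤ f n + C * d := by
  induction d with
  | zero => simp
  | succ d ih =>
    rw [mul_add_one, ← add_assoc n, ← add_assoc]
    exact (hC _).trans (Nat.add_le_add_right ih C)

theorem iterate_add_le {f : ℕ → ℕ} {C : ℕ} (hf : Monotone f) (hC : ∀ n, f (n + 1) ≤ f n + C)
    (p n d : ℕ) : f^[p] (n + d) ≤ f^[p] n + C ^ p * d := by
  induction p with
  | zero => simp
  | succ p ih =>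
    rw [Function.iterate_succ_apply', Function.iterate_succ_apply']
    calc f (f^[p] (n + d)) ≤ f (f^[p] n + C ^ p * d) := hf ih
      _ ≤ f (f^[p] n) + C * (C ^ p * d) := apply_add_le hC _ _
      _ = f (f^[p] n) + C ^ (p + 1) * d := by ring

section LowerAdjoint

variable {f g : ℕ → ℕ} {C : ℕ}

theorem apply_lowerAdjoint_le (gc : GaloisConnection g f) (h0 : f 0 = 0)
    (hC : ∀ n, f (n + 1) ≤ f n + C) (n : ℕ) : f (g n) ≤ n + C := by
  rcases h : g n with _ | m
  · simp [h0]
  · have hm : f m < n := gc.lt_iff_lt.1 (by omega)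
    linarith [hC m]

/-- A form of the Lambek–Moser theorem: when `f m = m + h m`, it is the recursion
`g (n + 1) = n + 1 - h (g n)`. -/
theorem lowerAdjoint_succ_add_apply (gc : GaloisConnection g f) (hf : StrictMono f)
    (h0 : f 0 = 0) (hgap : ∀ n, f (n + 1) ≤ f n + 2) (n : ℕ) :
    g (n + 1) + f (g n) = n + 1 + g n := by
  have hle : n ≤ f (g n) := gc.le_u_l n
  have hmono : g n ≤ g (n + 1) := gc.monotone_l n.le_succ
  rcases hle.eq_or_lt with heq | hlt
  · have hlower : g n < g (n + 1) := gc.lt_iff_lt.2 (by omega)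
    have hupper : g (n + 1) ≤ g n + 1 :=
      gc.l_le (Nat.succ_le_of_lt (hle.trans_lt (hf (Nat.lt_succ_self _))))
    omega
  · have hupper : g (n + 1) ≤ g n := gc.l_le hlt
    rcases h : g n with _ | m
    · rw [h] at hlt
      omega
    · have hm : f m < n := gc.lt_iff_lt.1 (by omega)
      have := hgap m
      rw [h] at hlt hmono hupper
      omega

theorem tendsto_lowerAdjoint_div (gc : GaloisConnection g f) (h0 : f 0 = 0)
    (hC : ∀ n, f (n + 1) ≤ f n + C) {c : ℝ} (hc : c ≠ 0)
    (hf : Tendsto (fun n => (f n : ℝ) / n) atTop (𝓝 c)) :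
    Tendsto (fun n => (g n : ℝ) / n) atTop (𝓝 c⁻¹) := by
  have hg : Tendsto g atTop atTop :=
    tendsto_atTop.2 fun b => (eventually_gt_atTop (f b)).mono fun n hn => (gc.lt_iff_lt.2 hn).le
  have hfg : Tendsto (fun n => (f (g n) : ℝ) / n) atTop (𝓝 1) := by
    refine tendsto_div_of_abs_sub_le tendsto_natCast_div_self (C := C) fun n => ?_
    have hlower : (n : ℝ) ≤ f (g n) := mod_cast gc.le_u_l n
    have hupper : (f (g n) : ℝ) ≤ n + C := mod_cast apply_lowerAdjoint_le gc h0 hC n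
    rw [abs_of_nonneg (sub_nonneg.2 hlower)]
    linarith
  rw [← one_div]
  refine (hfg.div (hf.comp hg) hc).congr' ?_
  filter_upwards [(tendsto_atTop_of_tendsto_div one_pos hfg).eventually_ne_atTop 0] with n hn
  exact div_div_div_cancel_left' _ _ (Nat.cast_ne_zero.2 hn)

end LowerAdjoint

/-! ### Oscillation of the solutions of a convex recurrence -/

theorem mem_of_convex_recurrence {E : Type*} [AddCommGroup E] [Module ℝ E] {s : Set E}
    (hs : Convex ℝ s) {l : ℕ} {a : ℝ} (ha₀ : 0 ≤ a) (ha₁ : a ≤ 1) {u : ℕ → E}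
    (hu : ∀ p, u (p + l + 1) = a • u (p + l) + (1 - a) • u p) (hinit : ∀ p ≤ l, u p ∈ s) (p : ℕ) :
    u p ∈ s := by
  induction p using Nat.strong_induction_on with
  | _ p ih =>
    rcases le_or_gt p l with hp | hp
    · exact hinit p hp
    · obtain ⟨q, rfl⟩ := Nat.exists_eq_add_of_lt hp
      rw [add_comm l q, hu q]
      exact hs (ih _ (by omega)) (ih _ (by omega)) ha₀ (sub_nonneg.2 ha₁) (by ring)

section ConvexRecurrence

variable {l : ℕ} {a : ℝ} {u : ℕ → ℝ}

theorem add_pow_mul_sub_le (ha₀ : 0 ≤ a) (ha₁ : a ≤ 1)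
    (hu : ∀ p, u (p + l + 1) = a * u (p + l) + (1 - a) * u p) {m : ℝ} (hm : ∀ p, m ≤ u p) (j : ℕ) :
    m + a ^ j * (u l - m) ≤ u (j + l) := by
  induction j with
  | zero => simp
  | succ j ih =>
    calc m + a ^ (j + 1) * (u l - m) = a * (m + a ^ j * (u l - m)) + (1 - a) * m := by ring
      _ ≤ a * u (j + l) + (1 - a) * u j := by
          have := sub_nonneg.2 ha₁
          gcongr
          exact hm j
      _ = u (j + 1 + l) := by rw [← hu, add_right_comm]

theorem le_sub_pow_mul_sub (ha₀ : 0 ≤ a) (ha₁ : a ≤ 1)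
    (hu : ∀ p, u (p + l + 1) = a * u (p + l) + (1 - a) * u p) {M : ℝ} (hM : ∀ p, u p ≤ M) (j : ℕ) :
    u (j + l) ≤ M - a ^ j * (M - u l) := by
  have hneg := add_pow_mul_sub_le (u := -u) (l := l) ha₀ ha₁
    (fun p => by simp only [Pi.neg_apply, hu]; ring) (fun p => neg_le_neg (hM p)) j
  simp only [Pi.neg_apply] at hneg
  linarith

theorem abs_sub_le_of_convex_recurrence (ha₀ : 0 ≤ a) (ha₁ : a ≤ 1)
    (hu : ∀ p, u (p + l + 1) = a * u (p + l) + (1 - a) * u p) {m M : ℝ}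
    (hinit : ∀ p ≤ l, u p ∈ Set.Icc m M) (N p q : ℕ) :
    |u (p + N * (l + 1)) - u (q + N * (l + 1))| ≤ (1 - a ^ (l + 1)) ^ N * (M - m) := by
  induction N generalizing u m M with
  | zero =>
    have hmem := mem_of_convex_recurrence (convex_Icc m M) ha₀ ha₁ hu hinit
    simpa [Real.dist_eq] using Real.dist_le_of_mem_Icc (hmem p) (hmem q)
  | succ N ih =>
    have hmem := mem_of_convex_recurrence (convex_Icc m M) ha₀ ha₁ hu hinit
    have hshift : ∀ p ≤ l, u (p + (l + 1)) ∈
        Set.Icc (m + a ^ (l + 1) * (u l - m)) (M - a ^ (l + 1) * (M - u l)) := by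
      intro p hp
      have hpow : a ^ (l + 1) ≤ a ^ (p + 1) := pow_le_pow_of_le_one ha₀ ha₁ (by omega)
      have hlower := add_pow_mul_sub_le ha₀ ha₁ hu (fun p => (hmem p).1) (p + 1)
      have hupper := le_sub_pow_mul_sub ha₀ ha₁ hu (fun p => (hmem p).2) (p + 1)
      have hml := mul_le_mul_of_nonneg_right hpow (sub_nonneg.2 (hmem l).1)
      have hMl := mul_le_mul_of_nonneg_right hpow (sub_nonneg.2 (hmem l).2)
      rw [← add_assoc, add_right_comm]
      exact ⟨by linarith, by linarith⟩
    have hrec (p : ℕ) : u (p + l + 1 + (l + 1)) =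
        a * u (p + l + (l + 1)) + (1 - a) * u (p + (l + 1)) := by
      rw [show p + l + 1 + (l + 1) = p + (l + 1) + l + 1 by ring, hu,
        show p + (l + 1) + l = p + l + (l + 1) by ring]
    calc |u (p + (N + 1) * (l + 1)) - u (q + (N + 1) * (l + 1))|
        = |u (p + N * (l + 1) + (l + 1)) - u (q + N * (l + 1) + (l + 1))| := by
          simp only [Nat.succ_mul, add_assoc]
      _ ≤ (1 - a ^ (l + 1)) ^ N *
          (M - a ^ (l + 1) * (M - u l) - (m + a ^ (l + 1) * (u l - m))) :=
          ih (u := fun p => u (p + (l + 1))) hrec hshift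
      _ = (1 - a ^ (l + 1)) ^ (N + 1) * (M - m) := by ring

end ConvexRecurrence

/-! ### Functions satisfying `f^(l+1) = f^l + id` -/

section IterateRecurrence

variable {f : ℕ → ℕ} {l C : ℕ} {a : ℝ}

theorem apply_zero_of_iterate_recurrence (hf : Function.Injective f)
    (hrec : ∀ n, f^[l + 1] n = f^[l] n + n) : f 0 = 0 :=
  hf.iterate l (hrec 0)

theorem pow_mul_iterate_recurrence (ha : a ^ (l + 1) + a = 1)
    (hrec : ∀ n, f^[l + 1] n = f^[l] n + n) (n p : ℕ) :
    a ^ (p + l + 1) * (f^[p + l + 1] n : ℝ) =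
      a * (a ^ (p + l) * f^[p + l] n) + (1 - a) * (a ^ p * f^[p] n) := by
  have horbit : f^[p + l + 1] n = f^[p + l] n + f^[p] n := by
    rw [show p + l + 1 = l + 1 + p by ring, Function.iterate_add_apply f (l + 1) p, hrec,
      ← Function.iterate_add_apply, add_comm l]
  rw [horbit, ← eq_sub_of_add_eq ha]
  push_cast
  ring

theorem pow_mul_iterate_mem_Icc (hf : StrictMono f) (h0 : f 0 = 0)
    (hC : ∀ n, f (n + 1) ≤ f n + C) (ha₀ : 0 ≤ a) (ha₁ : a ≤ 1) (n : ℕ) {p : ℕ} (hp : p ≤ l) :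
    a ^ p * (f^[p] n : ℝ) ∈ Set.Icc (a ^ l * n) (C ^ l * n : ℝ) := by
  have hlower : (n : ℝ) ≤ f^[p] n := mod_cast (hf.iterate p).le_apply
  have hupper : f^[p] n ≤ C ^ l * n :=
    calc f^[p] n ≤ f^[l] n := Function.monotone_iterate_of_id_le (fun _ => hf.le_apply) hp n
      _ ≤ C ^ l * n := by
          simpa [Function.iterate_fixed h0] using iterate_add_le hf.monotone hC l 0 n
  constructor
  · exact mul_le_mul (pow_le_pow_of_le_one ha₀ ha₁ hp) hlower n.cast_nonneg (by positivity)
  · exact (mul_le_of_le_one_left (Nat.cast_nonneg _) (pow_le_one₀ ha₀ ha₁)).trans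
      (mod_cast hupper)

theorem abs_apply_iterate_sub_le (hf : StrictMono f) (hC : ∀ n, f (n + 1) ≤ f n + C)
    (hrec : ∀ n, f^[l + 1] n = f^[l] n + n) (ha₀ : 0 < a) (ha : a ^ (l + 1) + a = 1) (N n : ℕ) :
    |(f (f^[N * (l + 1)] n) : ℝ) - a⁻¹ * f^[N * (l + 1)] n| ≤
      (1 - a ^ (l + 1)) ^ N * (C ^ l / a ^ (l + 1)) * f^[N * (l + 1)] n := by
  have ha_pow : 0 < a ^ (l + 1) := by positivity
  have ha₁ : a ≤ 1 := by linarith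
  have hwindow : ∀ p ≤ l, a ^ p * (f^[p] n : ℝ) ∈ Set.Icc (a ^ l * n) (C ^ l * n : ℝ) :=
    fun p => pow_mul_iterate_mem_Icc hf (apply_zero_of_iterate_recurrence hf.injective hrec)
      hC ha₀.le ha₁ n
  have hu := pow_mul_iterate_recurrence ha hrec n
  have hosc := abs_sub_le_of_convex_recurrence ha₀.le ha₁ hu hwindow N 1 0
  have hlower := (mem_of_convex_recurrence (u := fun p => a ^ p * (f^[p] n : ℝ))
    (convex_Icc _ _) ha₀.le ha₁ hu hwindow (N * (l + 1))).1
  rw [zero_add, add_comm 1, Function.iterate_succ_apply'] at hosc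
  set P := N * (l + 1)
  set q := f^[P] n
  have hθ : 0 ≤ 1 - a ^ (l + 1) := by linarith
  have hscale : a ^ (P + 1) * f q - a ^ P * q = a ^ (P + 1) * (f q - a⁻¹ * q) := by
    field_simp
    ring
  refine le_of_mul_le_mul_left ?_ (pow_pos ha₀ (P + 1))
  calc a ^ (P + 1) * |(f q : ℝ) - a⁻¹ * q| = |a ^ (P + 1) * f q - a ^ P * q| := by
        rw [hscale, abs_mul, abs_of_pos (pow_pos ha₀ (P + 1))]
    _ ≤ (1 - a ^ (l + 1)) ^ N * (C ^ l * n - a ^ l * n) := hosc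
    _ ≤ (1 - a ^ (l + 1)) ^ N * (C ^ l / a ^ l * (a ^ l * n)) := by
        gcongr
        rw [← mul_assoc, div_mul_cancel₀ _ (by positivity)]
        exact sub_le_self _ (by positivity)
    _ ≤ (1 - a ^ (l + 1)) ^ N * (C ^ l / a ^ l * (a ^ P * q)) := by gcongr
    _ = a ^ (P + 1) * ((1 - a ^ (l + 1)) ^ N * (C ^ l / a ^ (l + 1)) * q) := by
        field_simp
        ring

theorem exists_abs_apply_iterate_sub_le (hf : StrictMono f) (hC : ∀ n, f (n + 1) ≤ f n + C)
    (hrec : ∀ n, f^[l + 1] n = f^[l] n + n) (ha₀ : 0 < a) (ha : a ^ (l + 1) + a = 1)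
    {ε : ℝ} (hε : 0 < ε) : ∃ p, ∀ n, |(f (f^[p] n) : ℝ) - a⁻¹ * f^[p] n| ≤ ε * f^[p] n := by
  have ha_pow : 0 < a ^ (l + 1) := by positivity
  have hdecay : Tendsto (fun N : ℕ => (1 - a ^ (l + 1)) ^ N * (C ^ l / a ^ (l + 1)))
      atTop (𝓝 0) := by
    simpa only [zero_mul] using (tendsto_pow_atTop_nhds_zero_of_lt_one
      (r := 1 - a ^ (l + 1)) (by linarith) (by linarith)).mul_const (C ^ l / a ^ (l + 1))
  obtain ⟨N, hN⟩ := (hdecay.eventually_lt_const hε).exists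
  exact ⟨N * (l + 1), fun n => (abs_apply_iterate_sub_le hf hC hrec ha₀ ha N n).trans (by gcongr)⟩

theorem abs_apply_sub_mul_le (hf : Monotone f) (hC : ∀ n, f (n + 1) ≤ f n + C)
    {n q D : ℕ} {c ε : ℝ} (hc : 0 ≤ c) (hε : 0 ≤ ε) (hnq : n ≤ q) (hqn : q ≤ n + D)
    (hq : |(f q : ℝ) - c * q| ≤ ε * q) : |(f n : ℝ) - c * n| ≤ ε * n + (ε + C + c) * D := by
  have hnq' : (n : ℝ) ≤ q := mod_cast hnq
  have hqn' : (q : ℝ) ≤ n + D := mod_cast hqn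
  have hfq : |(f q : ℝ) - f n| ≤ C * D := by
    have hlower : (f n : ℝ) ≤ f q := mod_cast hf hnq
    have hupper : (f q : ℝ) ≤ f n + C * D := mod_cast (hf hqn).trans (apply_add_le hC n D)
    rw [abs_of_nonneg (sub_nonneg.2 hlower)]
    linarith
  have hcq : |c * (q : ℝ) - c * n| ≤ c * D := by
    rw [← mul_sub, abs_of_nonneg (mul_nonneg hc (sub_nonneg.2 hnq'))]
    gcongr
    linarith
  calc |(f n : ℝ) - c * n|
      = |((f q : ℝ) - c * q) - (f q - f n) + (c * q - c * n)| := by ring_nf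
    _ ≤ |(f q : ℝ) - c * q| + |(f q : ℝ) - f n| + |c * (q : ℝ) - c * n| :=
        (abs_add_le _ _).trans (by gcongr; exact abs_sub _ _)
    _ ≤ ε * (n + D) + C * D + c * D := by
        gcongr
        exact hq.trans (by gcongr)
    _ = ε * n + (ε + C + c) * D := by ring

theorem tendsto_div_of_iterate_recurrence (hf : StrictMono f) (hC : ∀ n, f (n + 1) ≤ f n + C)
    (hrec : ∀ n, f^[l + 1] n = f^[l] n + n) (ha₀ : 0 < a) (ha : a ^ (l + 1) + a = 1) :
    Tendsto (fun n => (f n : ℝ) / n) atTop (𝓝 a⁻¹) := by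
  refine tendsto_div_of_abs_sub_le_mul_add fun ε hε => ?_
  obtain ⟨p, hp⟩ := exists_abs_apply_iterate_sub_le hf hC hrec ha₀ ha hε
  obtain ⟨g, gc⟩ := exists_lowerAdjoint hf
  have gcp := galoisConnection_iterate gc p
  have h0 : f^[p] 0 = 0 :=
    Function.iterate_fixed (apply_zero_of_iterate_recurrence hf.injective hrec) p
  have hgap (n : ℕ) : f^[p] (n + 1) ≤ f^[p] n + C ^ p := by
    simpa using iterate_add_le hf.monotone hC p n 1
  exact ⟨_, fun n => abs_apply_sub_mul_le hf.monotone hC (inv_pos.2 ha₀).le hε.le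
    (gcp.le_u_l n) (apply_lowerAdjoint_le gcp h0 hgap n) (hp _)⟩

end IterateRecurrence

/-! ### Letters of the images under `τ_k` -/

theorem countP_tau {k : ℕ} {p q : ℕ → Bool} {w : List ℕ}
    (h : ∀ b ∈ w, (tauLetter k b).countP q = [b].countP p) :
    (tau k w).countP q = w.countP p := by
  conv_rhs => rw [← List.flatMap_singleton' w]
  rw [tau, List.countP_flatMap, List.countP_flatMap]
  exact congrArg List.sum (List.map_congr_left h)

theorem length_tau (k : ℕ) (w : List ℕ) : (tau k w).length = w.length + w.count k := by
  induction w with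
  | nil => rfl
  | cons b w ih =>
    have hb : (tauLetter k b).length = 1 + [b].count k := by
      by_cases hbk : b = k <;> simp [tauLetter, hbk]
    rw [← List.singleton_append, tau_append, List.length_append, List.length_append, ih,
      List.count_append, tau, List.flatMap_singleton, hb, List.length_singleton]
    ring

theorem countP_succ_le_tau {k i : ℕ} (hi : 1 ≤ i) (hik : i < k) (w : List ℕ) :
    (tau k w).countP (i + 1 ≤ ·) = w.countP (i ≤ ·) := by
  refine countP_tau fun b _ => ?_
  by_cases hb : b = k
  · subst hb
    simp [tauLetter, hik, hik.le, Nat.ne_of_gt hi]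
  · simp [tauLetter, hb, List.countP_cons]

theorem countP_le_iterate_tau {k j : ℕ} (hj : j < k) (w : List ℕ) :
    ((tau k)^[j] w).countP (j + 1 ≤ ·) = w.countP (1 ≤ ·) := by
  induction j with
  | zero => rfl
  | succ j ih =>
    rw [Function.iterate_succ_apply', countP_succ_le_tau (by omega) hj, ih (by omega)]

/-! ### Letter counts and lengths in `x_k` -/

theorem semiconj_pref_lenL_tau (k : ℕ) : Function.Semiconj (pref (word k)) (lenL k) (tau k) :=
  fun n => (isFixedWord_word k n).symm

theorem mem_pref_word {k : ℕ} (hk : 1 ≤ k) {n b : ℕ} (hb : b ∈ pref (word k) n) :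
    1 ≤ b ∧ b ≤ k := by
  obtain ⟨p, -, rfl⟩ := List.mem_map.1 hb
  exact word_mem k hk p

theorem letterCount_eq_natCount (k i n : ℕ) :
    letterCount k i n = Nat.count (fun p => word k p = i) n :=
  (Nat.count_eq_card_filter_range _ n).symm

theorem letterCount_eq_count_pref (k i n : ℕ) : letterCount k i n = (pref (word k) n).count i := by
  rw [letterCount_eq_natCount, pref, List.count, List.countP_map]
  rfl

theorem letterCount_succ (k i n : ℕ) :
    letterCount k i (n + 1) = letterCount k i n + if word k n = i then 1 else 0 := by
  simp only [letterCount_eq_natCount, Nat.count_succ]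

theorem letterCount_mono (k i : ℕ) : Monotone (letterCount k i) := by
  rw [funext (letterCount_eq_natCount k i)]
  exact Nat.count_monotone _

theorem letterCount_add_le (k i n d : ℕ) : letterCount k i (n + d) ≤ letterCount k i n + d := by
  rw [letterCount_eq_natCount, letterCount_eq_natCount, Nat.count_add]
  exact Nat.add_le_add_left (Nat.count_le _) _

theorem letterCount_lenL {k i i' : ℕ} (hk : 1 ≤ k)
    (h : ∀ b, 1 ≤ b → b ≤ k → (tauLetter k b).count i' = [b].count i) (n : ℕ) :
    letterCount k i' (lenL k n) = letterCount k i n := by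
  rw [letterCount_eq_count_pref, letterCount_eq_count_pref, semiconj_pref_lenL_tau]
  exact countP_tau fun b hb => h b (mem_pref_word hk hb).1 (mem_pref_word hk hb).2

theorem letterCount_one_lenL {k : ℕ} (hk : 1 < k) (n : ℕ) :
    letterCount k 1 (lenL k n) = letterCount k k n := by
  refine letterCount_lenL hk.le (fun b hb _ => ?_) n
  by_cases hbk : b = k
  · simp [tauLetter, hbk, hk.ne']
  · simp [tauLetter, hbk, Nat.ne_of_gt hb]

theorem letterCount_succ_lenL {k i : ℕ} (hi : 1 ≤ i) (hik : i + 1 < k) (n : ℕ) :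
    letterCount k (i + 1) (lenL k n) = letterCount k i n := by
  refine letterCount_lenL (by omega) (fun b _ _ => ?_) n
  by_cases hbk : b = k
  · simp [tauLetter, hbk, Nat.ne_of_gt hi, hik.ne', (Nat.lt_of_succ_lt hik).ne']
  · simp [tauLetter, hbk, List.count_cons]

theorem lenL_eq_add_letterCount (k n : ℕ) : lenL k n = n + letterCount k k n := by
  rw [lenL, length_tau, length_pref, letterCount_eq_count_pref]

theorem lenL_zero (k : ℕ) : lenL k 0 = 0 := rfl

theorem lenL_strictMono (k : ℕ) : StrictMono (lenL k) := by
  rw [funext (lenL_eq_add_letterCount k)]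
  exact strictMono_id.add_monotone (letterCount_mono k k)

theorem lenL_succ_le (k n : ℕ) : lenL k (n + 1) ≤ lenL k n + 2 := by
  rw [lenL_eq_add_letterCount, lenL_eq_add_letterCount]
  linarith [letterCount_add_le k k n 1]

theorem letterCount_iterate_lenL {k : ℕ} (hk : 1 ≤ k) (n : ℕ) :
    letterCount k k ((lenL k)^[k - 1] n) = n := by
  have hpref := (semiconj_pref_lenL_tau k).iterate_right (k - 1) n
  have hletters : ∀ b ∈ pref (word k) ((lenL k)^[k - 1] n), b = k ↔ k - 1 + 1 ≤ b := by
    intro b hb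
    have := mem_pref_word hk hb
    omega
  calc letterCount k k ((lenL k)^[k - 1] n)
      = (pref (word k) ((lenL k)^[k - 1] n)).countP (k - 1 + 1 ≤ ·) := by
        rw [letterCount_eq_count_pref]
        exact List.countP_congr fun b hb => by simpa using hletters b hb
    _ = (pref (word k) n).countP (1 ≤ ·) := by
        rw [hpref, countP_le_iterate_tau (by omega)]
    _ = n := by
        rw [List.countP_eq_length.2 fun b hb => by simpa using (mem_pref_word hk hb).1, length_pref]

theorem iterate_lenL_recurrence {k : ℕ} (hk : 1 ≤ k) (n : ℕ) :
    (lenL k)^[k - 1 + 1] n = (lenL k)^[k - 1] n + n := by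
  rw [Function.iterate_succ_apply', lenL_eq_add_letterCount, letterCount_iterate_lenL hk]

theorem pref_succ (w : ℕ → ℕ) (n : ℕ) : pref w (n + 1) = pref w n ++ [w n] := by
  simp [pref, List.range_succ]

theorem word_lenL {k : ℕ} (hk : 1 ≤ k) (n : ℕ) : word k (lenL k n) = min (word k n + 1) k := by
  have hblock : pref (word k) (lenL k (n + 1)) =
      pref (word k) (lenL k n) ++ tauLetter k (word k n) := by
    rw [semiconj_pref_lenL_tau, pref_succ, tau_append, ← semiconj_pref_lenL_tau, tau,
      List.flatMap_singleton]
  have hlt : lenL k n < lenL k (n + 1) := lenL_strictMono k n.lt_succ_self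
  have hhead : (tauLetter k (word k n))[0]? = some (min (word k n + 1) k) := by
    have := (word_mem k hk n).2
    by_cases hn : word k n = k
    · simp [tauLetter, hn]
    · simp [tauLetter, hn, show word k n + 1 ≤ k by omega]
  have hget := congrArg (fun v => v[lenL k n]?) hblock
  rw [List.getElem?_append_right (length_pref _ _).le, length_pref, Nat.sub_self, hhead] at hget
  simpa [pref, hlt] using hget

theorem word_iterate_lenL {k : ℕ} (hk : 1 ≤ k) (j n : ℕ) :
    word k ((lenL k)^[j] n) = min (word k n + j) k := by
  induction j with
  | zero => exact (min_eq_left (word_mem k hk n).2).symm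
  | succ j ih =>
    rw [Function.iterate_succ_apply', word_lenL hk, ih]
    omega

theorem galoisConnection_letterCount_iterate_lenL {k : ℕ} (hk : 1 ≤ k) :
    GaloisConnection (letterCount k k) (lenL k)^[k - 1] := by
  intro n m
  have hcount := letterCount_iterate_lenL hk m
  constructor
  · intro hle
    by_contra! hlt
    have hword : word k ((lenL k)^[k - 1] m) = k := by
      have := (word_mem k hk m).1
      rw [word_iterate_lenL hk]
      omega
    have hsucc := letterCount_succ k k ((lenL k)^[k - 1] m)
    rw [hcount, if_pos hword] at hsucc
    have hmono : letterCount k k ((lenL k)^[k - 1] m + 1) ≤ letterCount k k n :=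
      letterCount_mono k k hlt
    omega
  · intro hle
    exact (letterCount_mono k k hle).trans_eq hcount

/-! ### `F_k` is the lower adjoint of `L_k` -/

theorem eq_hofF_of_succ_add {k : ℕ} {g : ℕ → ℕ} (h0 : g 0 = 0)
    (hg : ∀ n, g (n + 1) + g^[k] n = n + 1) : g = hofF k := by
  funext n
  induction n using Nat.strong_induction_on with
  | _ n ih =>
    rcases n with _ | n
    · exact h0
    · have hiter (j : ℕ) : g^[j] n = (hofF k)^[j] n := by
        induction j with
        | zero => rfl
        | succ j ihj =>
          have hle : (hofF k)^[j] n ≤ n :=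
            Function.antitone_iterate_of_le_id (hofF_le k) j.zero_le n
          rw [Function.iterate_succ_apply', Function.iterate_succ_apply', ihj,
            ih _ (Nat.lt_succ_of_le hle)]
      have := hg n
      have := hofF_succ_add k n
      rw [hiter] at *
      omega

theorem galoisConnection_hofF_lenL {k : ℕ} (hk : 1 ≤ k) :
    GaloisConnection (hofF k) (lenL k) := by
  obtain ⟨g, gc⟩ := exists_lowerAdjoint (lenL_strictMono k)
  have hcount : letterCount k k = g^[k - 1] :=
    funext fun _ => (galoisConnection_letterCount_iterate_lenL hk).l_unique
      (galoisConnection_iterate gc (k - 1)) fun _ => rfl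
  have hrec (n : ℕ) : g (n + 1) + g^[k] n = n + 1 := by
    have hsucc := lowerAdjoint_succ_add_apply gc (lenL_strictMono k) (lenL_zero k)
      (lenL_succ_le k) n
    rw [lenL_eq_add_letterCount, hcount, ← Function.iterate_succ_apply, Nat.succ_eq_add_one,
      Nat.sub_add_cancel hk] at hsucc
    omega
  have hg0 : g 0 = 0 := Nat.le_zero.1 (gc.l_le (Nat.zero_le _))
  rwa [← eq_hofF_of_succ_add hg0 hrec]

/-! ### The limits -/

theorem alpha_pow_add_alpha (k : ℕ) (hk : 1 ≤ k) : alpha k hk ^ k + alpha k hk = 1 := by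
  simpa [polyP, Polynomial.IsRoot, sub_eq_zero] using (alpha_spec k hk).2

theorem alpha_pow_pred (k : ℕ) (hk : 1 ≤ k) : alpha k hk ^ (k - 1) = beta k hk - 1 := by
  have hα := (alpha_spec k hk).1.ne'
  rw [beta_eq, eq_sub_iff_add_eq, eq_div_iff hα, add_mul, one_mul, ← pow_succ,
    Nat.sub_add_cancel hk, alpha_pow_add_alpha]

theorem tendsto_lenL_div (k : ℕ) (hk : 1 ≤ k) :
    Tendsto (fun n => (lenL k n : ℝ) / n) atTop (𝓝 (beta k hk)) := by
  rw [beta_eq, one_div]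
  refine tendsto_div_of_iterate_recurrence (lenL_strictMono k) (lenL_succ_le k)
    (iterate_lenL_recurrence hk) (alpha_spec k hk).1 ?_
  rw [Nat.sub_add_cancel hk, alpha_pow_add_alpha]

theorem tendsto_hofF_div (k : ℕ) (hk : 1 ≤ k) :
    Tendsto (fun n => (hofF k n : ℝ) / n) atTop (𝓝 (alpha k hk)) := by
  have h := tendsto_lowerAdjoint_div (galoisConnection_hofF_lenL hk) (lenL_zero k) (lenL_succ_le k)
    (beta_spec k hk).1.ne' (tendsto_lenL_div k hk)
  rwa [beta_eq, one_div, inv_inv] at h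

theorem hasFreq_self (k : ℕ) (hk : 1 ≤ k) : HasFreq k k (alpha k hk ^ (k - 1)) := by
  rw [alpha_pow_pred]
  refine ((tendsto_lenL_div k hk).sub tendsto_natCast_div_self).congr fun n => ?_
  rw [lenL_eq_add_letterCount, ← sub_div, Nat.cast_add, add_sub_cancel_left]

theorem HasFreq.of_letterCount_lenL {k i i' : ℕ} {ℓ : ℝ} (hk : 1 ≤ k) (hi : HasFreq k i ℓ)
    (h : ∀ n, letterCount k i' (lenL k n) = letterCount k i n) :
    HasFreq k i' (ℓ * alpha k hk) := by
  have gc := galoisConnection_hofF_lenL hk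
  have hcomp := tendsto_comp_div (alpha_spec k hk).1 hi (tendsto_hofF_div k hk)
  refine tendsto_div_of_abs_sub_le hcomp (C := 2) fun n => ?_
  have hlower : letterCount k i' n ≤ letterCount k i (hofF k n) :=
    (letterCount_mono k i' (gc.le_u_l n)).trans_eq (h _)
  have hupper : letterCount k i (hofF k n) ≤ letterCount k i' n + 2 :=
    calc letterCount k i (hofF k n) = letterCount k i' (lenL k (hofF k n)) := (h _).symm
      _ ≤ letterCount k i' (n + 2) :=
          letterCount_mono k i' (apply_lowerAdjoint_le gc (lenL_zero k) (lenL_succ_le k) n)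
      _ ≤ letterCount k i' n + 2 := letterCount_add_le k i' n 2
  rw [← Nat.cast_le (α := ℝ)] at hlower hupper
  push_cast at hupper
  rw [abs_of_nonpos (sub_nonpos.2 hlower)]
  linarith

theorem hasFreq_of_lt (k : ℕ) (hk : 1 ≤ k) (i : ℕ) (hi : 1 ≤ i) (hik : i < k) :
    HasFreq k i (alpha k hk ^ (k + i - 1)) := by
  induction i, hi using Nat.le_induction with
  | base =>
    have := (hasFreq_self k hk).of_letterCount_lenL hk (letterCount_one_lenL hik)
    rwa [← pow_succ, Nat.sub_add_cancel hk] at this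
  | succ i hi ih =>
    have := (ih (by omega)).of_letterCount_lenL hk (letterCount_succ_lenL hi hik)
    rwa [← pow_succ, Nat.sub_add_cancel (by omega)] at this

end Hofstadter

theorem theorem6p1 (k : ℕ) (hk : 1 ≤ k) :
    (∀ j : ℕ, Filter.Tendsto (fun n : ℕ => (((Hofstadter.hofF k)^[j] n : ℕ) : ℝ) / (n : ℝ))
      Filter.atTop (nhds (Hofstadter.alpha k hk ^ j))) ∧
    (∀ j : ℕ, Filter.Tendsto (fun n : ℕ => (((Hofstadter.lenL k)^[j] n : ℕ) : ℝ) / (n : ℝ))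
      Filter.atTop (nhds (Hofstadter.beta k hk ^ j))) ∧
    (∀ i : ℕ, 1 ≤ i → i < k → Hofstadter.HasFreq k i (Hofstadter.alpha k hk ^ (k + i - 1))) ∧
    Hofstadter.HasFreq k k (Hofstadter.alpha k hk ^ (k - 1)) ∧
    Hofstadter.alpha k hk ^ (k - 1) = Hofstadter.beta k hk - 1 :=
  ⟨Hofstadter.tendsto_iterate_div (Hofstadter.alpha_spec k hk).1
      (Hofstadter.tendsto_hofF_div k hk),
    Hofstadter.tendsto_iterate_div (Hofstadter.beta_spec k hk).1
      (Hofstadter.tendsto_lenL_div k hk),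
    Hofstadter.hasFreq_of_lt k hk,
    Hofstadter.hasFreq_self k hk,
    Hofstadter.alpha_pow_pred k hk⟩
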